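/- Let $G$ be a finite group and let $(G,H,L)$ be a Frobenius–Wielandt group; that is, $H$ is a nontrivial proper subgroup of $G$, $L$ is a normal subgroup of $H$ with $L\neq H$, and $H^g\cap H\le L$ for every $g\in G\setminus H$, where $H^g=g^{-1}Hg$. Suppose that $M\lhd G$ satisfies $G=HM$ and $H\cap M=1$. Then the Frobenius–Wielandt kernel $N$ of $(G,H,L)$, i.e. the unique normal subgroup $N$ of $G$ with $G=NH$ and $N\cap H=L$, which is given by $N=G\setminus\bigcup_{g\in G}(H\setminus L)^g$, satisfies $N=LM$, and $(G,N,M)$ is a Frobenius triple; that is, $M\le N$ are nontrivial proper normal subgroups of $G$ and $C_G(x)\le N$ for every $1\neq x\in M$. In particular, $C_M(g)=1$ for every $g\in G\setminus N$, and the induced character $\psi^G$ is irreducible for every $\psi\in\mathrm{Irr}(N\mid M)$, where $\mathrm{Irr}(N\mid M)$ denotes the set of irreducible complex characters of $N$ whose kernel does not contain $M$. -/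

import Mathlib

open scoped Pointwise

noncomputable section

/-- `(G, H, L)` is a Frobenius–Wielandt triple: `H` is a nontrivial proper subgroup of `G`, `L` is a
proper normal subgroup of `H`, and `H ^ g ∩ H ≤ L` for all `g ∈ G \ H`, where
`H ^ g = g⁻¹ H g`. -/
structure IsFrobeniusWielandt {G : Type*} [Group G] (H L : Subgroup G) : Prop where
  nontrivial : H ≠ ⊥
  proper : H ≠ ⊤
  lt : L < H
  normal : (L.subgroupOf H).Normal
  inf_le : ∀ g : G, g ∉ H → H.map (MulAut.conj g⁻¹).toMonoidHom ⊓ H ≤ L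

/-- The set `G \ ⋃_{g ∈ G} (H \ L) ^ g`. -/
def fwKernelSet {G : Type*} [Group G] (H L : Subgroup G) : Set G :=
  (⋃ g : G, (fun h : G => g⁻¹ * h * g) '' ((H : Set G) \ (L : Set G)))ᶜ

/-- `N` is the Frobenius–Wielandt kernel of `(G, H, L)`: the unique normal subgroup `N` of `G` with
`G = N H` and `N ∩ H = L`, which is given as a set by `G \ ⋃_{g ∈ G} (H \ L) ^ g`. -/
structure IsFrobeniusWielandtKernel {G : Type*} [Group G] (H L N : Subgroup G) : Prop where
  normal : N.Normal
  mul_eq : (N : Set G) * (H : Set G) = Set.univ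
  inf_eq : N ⊓ H = L
  unique : ∀ K : Subgroup G, K.Normal → (K : Set G) * (H : Set G) = Set.univ → K ⊓ H = L → K = N
  coe_eq : (N : Set G) = fwKernelSet H L

/-- `(G, N, M)` is a Frobenius triple. -/
structure IsFrobeniusTriple {G : Type*} [Group G] (N M : Subgroup G) : Prop where
  normal_top : N.Normal
  normal_bot : M.Normal
  top_ne_bot : N ≠ ⊥
  top_ne_top : N ≠ ⊤
  bot_ne_bot : M ≠ ⊥
  bot_ne_top : M ≠ ⊤
  le : M ≤ N
  centralizer_le : ∀ x ∈ M, x ≠ 1 → Subgroup.centralizer {x} ≤ N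

/-- `Irr(G)`: the set of characters of irreducible complex representations of finite degree. -/
def Irr (G : Type*) [Group G] : Set (G → ℂ) :=
  {χ | ∃ (n : ℕ) (ρ : Representation ℂ G (Fin n → ℂ)), ρ.IsIrreducible ∧ ρ.character = χ}

/-- The kernel `{g ∈ G | χ(g) = χ(1)}` of a character `χ` of `G`, as a set. -/
def charKer {G : Type*} [Group G] (χ : G → ℂ) : Set G :=
  {g | χ g = χ 1}

/-- `Irr(N | M)` for subgroups `M ≤ N` of `G`: the irreducible characters of `N` that do not contain
`M` in their kernel. -/
def IrrOver {G : Type*} [Group G] (N M : Subgroup G) : Set (N → ℂ) :=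
  {ψ | ψ ∈ Irr N ∧ ¬ ((M.subgroupOf N : Set N) ⊆ charKer ψ)}

open Classical in
/-- The induced character `ψ^G(g) = |N|⁻¹ ∑_{x ∈ G} ψ°(x g x⁻¹)`, where `ψ°` is `ψ` extended by zero
from `N` to `G`. -/
def inducedChar {G : Type*} [Group G] [Fintype G] (N : Subgroup G) (ψ : N → ℂ) : G → ℂ :=
  fun g => (Nat.card N : ℂ)⁻¹ *
    ∑ x : G, if h : x * g * x⁻¹ ∈ N then ψ ⟨x * g * x⁻¹, h⟩ else 0

end

/-! Everything rests on one counting argument. If `h ∈ H \ L`, the Frobenius–Wielandt condition puts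
the centralizer of `h` inside `H`, so it meets `M` trivially and `M` permutes the coset `hM`
transitively by conjugation. Since `G = HM`, every element outside `LM` is therefore conjugate to an
element of `H \ L`. The description of the kernel, its uniqueness and the triviality of `C_M(g)` for
`g ∉ LM` all follow.

For characters, let `ρ` afford `ψ` and suppose `T` intertwines `ρ` with its conjugate by some `z ∉
N`. Transitivity of `M` on the cosets `znM` makes `tr (T ρ(n))` constant on cosets of `M`; as `∑_{m
∈ M} ρ(m) = 0`, these traces vanish. By Burnside's theorem the `ρ(n)` span `End V`, so `tr (T T⁻¹) =
0`, which is absurd. Hence conjugates of `ψ` by different cosets of `N` are inequivalent, and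
orthogonality gives `ψ^G` norm one. -/

/-- If `g` centralizes no nontrivial element of the finite normal subgroup `M`, then `M` acts
transitively by conjugation on the coset `g M`. -/
theorem Subgroup.exists_conj_eq_mul_of_centralizer_inf_eq_bot {G : Type*} [Group G] [Finite G]
    {M : Subgroup G} [hM : M.Normal] {g : G} (hg : Subgroup.centralizer {g} ⊓ M = ⊥)
    {m : G} (hm : m ∈ M) : ∃ x ∈ M, x⁻¹ * g * x = g * m := by
  let f : M → M := fun x => ⟨g⁻¹ * (x : G)⁻¹ * g * x,
    M.mul_mem (by simpa using hM.conj_mem _ (M.inv_mem x.2) g⁻¹) x.2⟩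
  have hinj : Function.Injective f := by
    rintro ⟨x, hx⟩ ⟨y, hy⟩ hxy
    have h1 : g⁻¹ * x⁻¹ * g * x = g⁻¹ * y⁻¹ * g * y := congrArg Subtype.val hxy
    have h2 : x⁻¹ * g * x = y⁻¹ * g * y := by
      simpa only [mul_assoc, mul_left_cancel_iff] using h1
    have h3 : x * y⁻¹ ∈ Subgroup.centralizer {g} ⊓ M := by
      refine ⟨Subgroup.mem_centralizer_singleton_iff.2 ?_, M.mul_mem hx (M.inv_mem hy)⟩
      calc x * y⁻¹ * g = x * (y⁻¹ * g * y) * y⁻¹ := by group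
        _ = x * (x⁻¹ * g * x) * y⁻¹ := by rw [h2]
        _ = g * (x * y⁻¹) := by group
    rw [hg, Subgroup.mem_bot, mul_inv_eq_one] at h3
    exact Subtype.ext h3
  obtain ⟨x, hx⟩ := Finite.surjective_of_injective hinj ⟨m, hm⟩
  refine ⟨x, x.2, ?_⟩
  rw [← show g⁻¹ * (x : G)⁻¹ * g * x = m from congrArg Subtype.val hx]
  group

/-! ### Group theory: the kernel is `LM`. -/

namespace IsFrobeniusWielandt

variable {G : Type*} [Group G] {H L M : Subgroup G}

/-- If `x` commutes with `h`, then `h = x⁻¹ h x` lies in `H ^ x ∩ H`, which is contained in `L`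
unless `x ∈ H`. -/
theorem mem_of_commute (hFW : IsFrobeniusWielandt H L) {h x : G} (hh : h ∈ H) (hL : h ∉ L)
    (hx : x * h = h * x) : x ∈ H := by
  by_contra hxH
  refine hL (hFW.inf_le x hxH ⟨⟨h, hh, ?_⟩, hh⟩)
  simp [mul_assoc, ← hx]

theorem centralizer_inf_eq_bot (hFW : IsFrobeniusWielandt H L) (hinf : H ⊓ M = ⊥) {h : G}
    (hh : h ∈ H) (hL : h ∉ L) : Subgroup.centralizer {h} ⊓ M = ⊥ := by
  refine (Subgroup.eq_bot_iff_forall _).2 fun x hx => ?_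
  have : x ∈ H ⊓ M :=
    ⟨hFW.mem_of_commute hh hL (Subgroup.mem_centralizer_singleton_iff.1 hx.1), hx.2⟩
  rwa [hinf, Subgroup.mem_bot] at this

theorem conj_mem (hFW : IsFrobeniusWielandt H L) {h l : G} (hh : h ∈ H) (hl : l ∈ L) :
    h * l * h⁻¹ ∈ L :=
  hFW.normal.conj_mem ⟨l, hFW.lt.le hl⟩ hl ⟨h, hh⟩

theorem sup_normal (hFW : IsFrobeniusWielandt H L) [hM : M.Normal]
    (hHM : (H : Set G) * (M : Set G) = Set.univ) : (L ⊔ M).Normal := by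
  refine ⟨fun n hn g => ?_⟩
  obtain ⟨h, hh, m, hm, rfl⟩ : g ∈ (H : Set G) * (M : Set G) := hHM ▸ Set.mem_univ g
  have hm' : m ∈ L ⊔ M := Subgroup.mem_sup_right hm
  -- The factor from `M` keeps `n` inside `LM`; the factor from `H` then normalizes `L` and `M`
  -- separately.
  have hc : m * n * m⁻¹ ∈ L ⊔ M := mul_mem (mul_mem hm' hn) (inv_mem hm')
  rw [← SetLike.mem_coe, Subgroup.mul_normal] at hc
  obtain ⟨l, hl, k, hk, hlk⟩ := hc
  have hlk : l * k = m * n * m⁻¹ := hlk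
  have : h * m * n * (h * m)⁻¹ = (h * l * h⁻¹) * (h * k * h⁻¹) := by
    calc h * m * n * (h * m)⁻¹ = h * (m * n * m⁻¹) * h⁻¹ := by group
      _ = _ := by rw [← hlk]; group
  change h * m * n * (h * m)⁻¹ ∈ L ⊔ M
  rw [this]
  exact mul_mem (Subgroup.mem_sup_left (hFW.conj_mem hh hl))
    (Subgroup.mem_sup_right (hM.conj_mem k hk h))

theorem sup_inf_eq (hFW : IsFrobeniusWielandt H L) [M.Normal] (hinf : H ⊓ M = ⊥) :
    (L ⊔ M) ⊓ H = L := by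
  refine le_antisymm ?_ (le_inf le_sup_left hFW.lt.le)
  rintro x ⟨hx, hxH⟩
  obtain ⟨l, hl, m, hm, rfl⟩ : x ∈ (L : Set G) * (M : Set G) := Subgroup.mul_normal L M ▸ hx
  have : m ∈ H ⊓ M := ⟨(H.mul_mem_cancel_left (hFW.lt.le hl)).1 hxH, hm⟩
  rw [hinf, Subgroup.mem_bot] at this
  simpa [this] using hl

/-- Every element outside `L M` is conjugate to an element of `H \ L`. -/
theorem exists_conj_of_notMem_sup (hFW : IsFrobeniusWielandt H L) [Finite G] [M.Normal]
    (hHM : (H : Set G) * (M : Set G) = Set.univ) (hinf : H ⊓ M = ⊥) {g : G} (hg : g ∉ L ⊔ M) :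
    ∃ x : G, ∃ h ∈ H, h ∉ L ∧ x⁻¹ * h * x = g := by
  obtain ⟨h, hh, m, hm, rfl⟩ : g ∈ (H : Set G) * (M : Set G) := hHM ▸ Set.mem_univ g
  have hL : h ∉ L := fun hl =>
    hg (mul_mem (Subgroup.mem_sup_left hl) (Subgroup.mem_sup_right hm))
  obtain ⟨x, -, hx⟩ := Subgroup.exists_conj_eq_mul_of_centralizer_inf_eq_bot
    (hFW.centralizer_inf_eq_bot hinf hh hL) hm
  exact ⟨x, h, hh, hL, hx⟩

theorem coe_sup_eq_fwKernelSet (hFW : IsFrobeniusWielandt H L) [Finite G] [M.Normal]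
    (hHM : (H : Set G) * (M : Set G) = Set.univ) (hinf : H ⊓ M = ⊥) :
    ((L ⊔ M : Subgroup G) : Set G) = fwKernelSet H L := by
  have hN := hFW.sup_normal hHM
  ext g
  simp only [fwKernelSet, Set.mem_compl_iff, Set.mem_iUnion, Set.mem_image, Set.mem_sdiff,
    SetLike.mem_coe]
  constructor
  · rintro hg ⟨x, h, ⟨hh, hL⟩, rfl⟩
    apply hL
    rw [← hFW.sup_inf_eq hinf]
    exact ⟨by simpa [mul_assoc] using hN.conj_mem _ hg x, hh⟩
  · intro hg
    by_contra hgN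
    obtain ⟨x, h, hh, hL, rfl⟩ := hFW.exists_conj_of_notMem_sup hHM hinf hgN
    exact hg ⟨x, h, ⟨hh, hL⟩, rfl⟩

theorem centralizer_inf_eq_bot_of_notMem_sup (hFW : IsFrobeniusWielandt H L) [Finite G]
    [hM : M.Normal] (hHM : (H : Set G) * (M : Set G) = Set.univ) (hinf : H ⊓ M = ⊥) {g : G}
    (hg : g ∉ L ⊔ M) : Subgroup.centralizer {g} ⊓ M = ⊥ := by
  obtain ⟨x, h, hh, hL, rfl⟩ := hFW.exists_conj_of_notMem_sup hHM hinf hg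
  refine (Subgroup.eq_bot_iff_forall _).2 fun y hy => ?_
  have hc := Subgroup.mem_centralizer_singleton_iff.1 hy.1
  have : x * y * x⁻¹ ∈ Subgroup.centralizer {h} ⊓ M := by
    refine ⟨Subgroup.mem_centralizer_singleton_iff.2 ?_, hM.conj_mem y hy.2 x⟩
    calc x * y * x⁻¹ * h = x * (y * (x⁻¹ * h * x)) * x⁻¹ := by group
      _ = h * (x * y * x⁻¹) := by rw [hc]; group
  rw [hFW.centralizer_inf_eq_bot hinf hh hL, Subgroup.mem_bot] at this
  simpa [mul_inv_eq_one] using this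

theorem isFrobeniusWielandtKernel_sup (hFW : IsFrobeniusWielandt H L) [Finite G] [M.Normal]
    (hHM : (H : Set G) * (M : Set G) = Set.univ) (hinf : H ⊓ M = ⊥) :
    IsFrobeniusWielandtKernel H L (L ⊔ M) where
  normal := hFW.sup_normal hHM
  mul_eq := by
    have := hFW.sup_normal hHM
    rw [← Subgroup.normal_mul, Set.eq_univ_iff_forall]
    intro g
    obtain ⟨h, hh, m, hm, rfl⟩ : g ∈ (H : Set G) * (M : Set G) := hHM ▸ Set.mem_univ g
    exact mul_mem (Subgroup.mem_sup_right hh)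
      (Subgroup.mem_sup_left (Subgroup.mem_sup_right hm))
  inf_eq := hFW.sup_inf_eq hinf
  unique K hK hKH hKinf := by
    -- An element of `K` outside `LM` would have a conjugate in `(K ∩ H) \ L`, which is empty.
    have hle : K ≤ L ⊔ M := by
      intro k hk
      by_contra hkN
      obtain ⟨x, h, hh, hL, rfl⟩ := hFW.exists_conj_of_notMem_sup hHM hinf hkN
      apply hL
      rw [← hKinf]
      exact ⟨by simpa [mul_assoc] using hK.conj_mem _ hk x, hh⟩
    refine le_antisymm hle fun n hn => ?_
    obtain ⟨k, hk, h, hh, rfl⟩ : n ∈ (K : Set G) * (H : Set G) := hKH ▸ Set.mem_univ n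
    have : h ∈ (L ⊔ M) ⊓ H := ⟨(Subgroup.mul_mem_cancel_left _ (hle hk)).1 hn, hh⟩
    rw [hFW.sup_inf_eq hinf, ← hKinf] at this
    exact K.mul_mem hk this.1
  coe_eq := hFW.coe_sup_eq_fwKernelSet hHM hinf

theorem isFrobeniusTriple_sup (hFW : IsFrobeniusWielandt H L) [Finite G] [hM : M.Normal]
    (hHM : (H : Set G) * (M : Set G) = Set.univ) (hinf : H ⊓ M = ⊥) :
    IsFrobeniusTriple (L ⊔ M) M where
  normal_top := hFW.sup_normal hHM
  normal_bot := hM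
  top_ne_bot h := by
    have hMb : M = ⊥ := (sup_eq_bot_iff.1 h).2
    refine hFW.proper (SetLike.coe_injective ?_)
    simpa [hMb] using hHM
  top_ne_top h := by
    have := hFW.sup_inf_eq hinf
    rw [h, top_inf_eq] at this
    exact hFW.lt.ne' this
  bot_ne_bot hMb := by
    refine hFW.proper (SetLike.coe_injective ?_)
    simpa [hMb] using hHM
  bot_ne_top h := hFW.nontrivial (by simpa [h] using hinf)
  le := le_sup_right
  centralizer_le x hx hx1 c hc := by
    by_contra hcN
    have : x ∈ Subgroup.centralizer {c} ⊓ M :=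
      ⟨Subgroup.mem_centralizer_singleton_iff.2
        (Subgroup.mem_centralizer_singleton_iff.1 hc).symm, hx⟩
    rw [hFW.centralizer_inf_eq_bot_of_notMem_sup hHM hinf hcN] at this
    exact hx1 this

end IsFrobeniusWielandt

/-! ### Irreducibility criteria and Burnside's theorem. -/

namespace Representation

open Module

section Monoid

variable {k G V W : Type*} [Field k] [Monoid G] [AddCommGroup V] [Module k V]
  [AddCommGroup W] [Module k W]

theorem isIrreducible_iff_forall_submodule (ρ : Representation k G V) :
    ρ.IsIrreducible ↔ Nontrivial V ∧
      ∀ p : Submodule k V, (∀ g, ∀ v ∈ p, ρ g v ∈ p) → p = ⊥ ∨ p = ⊤ := by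
  constructor
  · intro h
    refine ⟨?_, fun p hp => ?_⟩
    · by_contra hV
      rw [not_nontrivial_iff_subsingleton] at hV
      apply (bot_ne_top : (⊥ : Subrepresentation ρ) ≠ ⊤)
      exact Subrepresentation.toSubmodule_injective (Subsingleton.elim _ _)
    · exact (eq_bot_or_eq_top (⟨p, fun g v hv => hp g v hv⟩ : Subrepresentation ρ)).imp
        (congrArg Subrepresentation.toSubmodule) (congrArg Subrepresentation.toSubmodule)
  · rintro ⟨hV, h⟩
    exact
      { exists_pair_ne := ⟨⊥, ⊤, fun e => bot_ne_top (α := Submodule k V)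
          (congrArg Subrepresentation.toSubmodule e)⟩
        eq_bot_or_eq_top := fun p => (h p.toSubmodule fun g v hv =>
          p.apply_mem_toSubmodule g hv).imp
            (fun e => Subrepresentation.toSubmodule_injective e)
            (fun e => Subrepresentation.toSubmodule_injective e) }

theorem IsIrreducible.of_equiv {ρ : Representation k G V} {σ : Representation k G W}
    (e : ρ.Equiv σ) (h : ρ.IsIrreducible) : σ.IsIrreducible := by
  rw [isIrreducible_iff_forall_submodule] at h ⊢
  have := h.1
  refine ⟨e.toLinearEquiv.symm.toEquiv.nontrivial, fun p hp => ?_⟩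
  have key : p.comap e.toLinearEquiv.toLinearMap = ⊥ ∨ p.comap e.toLinearEquiv.toLinearMap = ⊤ := by
    refine h.2 _ fun g v hv => ?_
    have : e (ρ g v) = σ g (e v) := e.toIntertwiningMap.isIntertwining _ _ g v
    exact (congrArg (· ∈ p) this).mpr (hp g _ hv)
  have hmap : (p.comap e.toLinearEquiv.toLinearMap).map e.toLinearEquiv.toLinearMap = p :=
    Submodule.map_comap_eq_of_surjective e.toLinearEquiv.surjective p
  rcases key with h0 | h1
  · left; rw [← hmap, h0, Submodule.map_bot]
  · right; rw [← hmap, h1, Submodule.map_top, LinearEquiv.range]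

theorem IsIrreducible.comp_mulEquiv {G' : Type*} [Monoid G'] {ρ : Representation k G V}
    (h : ρ.IsIrreducible) (e : G' ≃* G) :
    IsIrreducible (ρ.comp e.toMonoidHom : Representation k G' V) := by
  rw [isIrreducible_iff_forall_submodule] at h ⊢
  refine ⟨h.1, fun p hp => h.2 p fun g v hv => ?_⟩
  simpa using hp (e.symm g) v hv

/-- **Burnside's theorem**: the operators of an irreducible representation over an algebraically
closed field span the full endomorphism algebra. -/
theorem IsIrreducible.asAlgebraHom_surjective [IsAlgClosed k] [FiniteDimensional k V]
    (ρ : Representation k G V) [ρ.IsIrreducible] : Function.Surjective ρ.asAlgebraHom := by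
  intro f
  have hs := IsSimpleModule.algebraMap_end_bijective_of_isAlgClosed k
    (A := MonoidAlgebra k G) (V := ρ.asModule)
  -- By Schur's lemma the commutant consists of scalars, so every linear `f` commutes with it and
  -- the density theorem applies; agreement on a finite spanning set is enough.
  let F : End (End (MonoidAlgebra k G) ρ.asModule) ρ.asModule :=
    { toFun := fun v => ρ.asModuleEquiv.symm (f (ρ.asModuleEquiv v))
      map_add' := fun x y => by simp
      map_smul' := fun a x => by
        obtain ⟨c, rfl⟩ := hs.2 a
        simp }
  obtain ⟨s, hs⟩ := (Module.Finite.fg_top (R := k) (M := ρ.asModule))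
  obtain ⟨r, hr⟩ := jacobson_density F s
  have hspan : ∀ w : ρ.asModule, F w = r • w := by
    intro w
    have hw : w ∈ Submodule.span k (s : Set ρ.asModule) := hs ▸ Submodule.mem_top
    induction hw using Submodule.span_induction with
    | mem w hw => exact hr w hw
    | zero => simp
    | add x y _ _ hx hy => rw [map_add, hx, hy, smul_add]
    | smul c x _ hx =>
      rw [smul_comm, ← hx]
      simp [F]
  refine ⟨r, LinearMap.ext fun v => ?_⟩
  have := congrArg ρ.asModuleEquiv (hspan (ρ.asModuleEquiv.symm v))
  simpa [F, asModuleEquiv_map_smul] using this.symm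

end Monoid

section Group

variable {k G V : Type*} [Field k] [Group G] [AddCommGroup V] [Module k V]

/-- By Maschke, an invariant subspace has an invariant complement. The projection along it is an
intertwiner, hence a scalar, so one of the two summands is zero. -/
theorem isIrreducible_of_finrank_intertwiningMap_eq_one [Finite G] [NeZero (Nat.card G : k)]
    (ρ : Representation k G V) (h : finrank k (IntertwiningMap ρ ρ) = 1) : ρ.IsIrreducible := by
  rw [isIrreducible_iff_forall_submodule]
  have hV : Nontrivial V := by
    by_contra hV
    rw [not_nontrivial_iff_subsingleton] at hV
    have : Subsingleton (IntertwiningMap ρ ρ) :=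
      ⟨fun a b => IntertwiningMap.ext (Subsingleton.elim _ _)⟩
    simp [finrank_zero_of_subsingleton] at h
  have hid : IntertwiningMap.id ρ ≠ 0 := by
    obtain ⟨v, hv⟩ := exists_ne (0 : V)
    exact fun e => hv (by simpa using congrArg (fun a : IntertwiningMap ρ ρ => a v) e)
  refine ⟨hV, fun p hp => ?_⟩
  obtain ⟨q, hq⟩ := exists_isCompl (⟨p, fun g v hv => hp g v hv⟩ : Subrepresentation ρ)
  have hpq : IsCompl p q.toSubmodule := by
    rw [isCompl_iff, disjoint_iff, codisjoint_iff] at hq ⊢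
    exact ⟨congrArg Subrepresentation.toSubmodule hq.1,
      congrArg Subrepresentation.toSubmodule hq.2⟩
  let π : IntertwiningMap ρ ρ := ⟨p.projection _ hpq, fun g => LinearMap.ext fun v => by
    obtain ⟨a, ha, b, hb, rfl⟩ := Submodule.mem_sup.1
      (show v ∈ p ⊔ q.toSubmodule from hpq.sup_eq_top ▸ Submodule.mem_top)
    simp [Submodule.projection_apply_of_mem_left hpq ha,
      Submodule.projection_apply_of_mem_left hpq (hp g a ha),
      Submodule.projection_apply_of_mem_right hpq hb,
      Submodule.projection_apply_of_mem_right hpq (q.apply_mem_toSubmodule g hb)]⟩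
  obtain ⟨c, hc⟩ := (finrank_eq_one_iff_of_nonzero' _ hid).1 h π
  have hcv : ∀ v, c • v = p.projection _ hpq v := fun v =>
    congrArg (fun a : IntertwiningMap ρ ρ => a v) hc
  rcases eq_or_ne c 0 with rfl | hc0
  · left
    refine (Submodule.eq_bot_iff _).2 fun v hv => ?_
    rw [← Submodule.projection_apply_of_mem_left hpq hv, ← hcv, zero_smul]
  · right
    have hq0 : q.toSubmodule = ⊥ := by
      refine (Submodule.eq_bot_iff _).2 fun v hv => ?_
      have := hcv v
      rw [Submodule.projection_apply_of_mem_right hpq hv] at this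
      exact (smul_eq_zero.1 this).resolve_left hc0
    simpa [hq0] using hpq.sup_eq_top

end Group

end Representation

/-! ### The character of a coinduced representation. -/

open Module

/-- The trace of an endomorphism of `ι → V` is the sum of the traces of its diagonal blocks. -/
theorem LinearMap.trace_pi_eq_sum {k ι V : Type*} [Field k] [Fintype ι] [DecidableEq ι]
    [AddCommGroup V] [Module k V] [FiniteDimensional k V] (f : (ι → V) →ₗ[k] (ι → V)) :
    LinearMap.trace k (ι → V) f =
      ∑ i, LinearMap.trace k V (LinearMap.proj i ∘ₗ f ∘ₗ LinearMap.single k (fun _ => V) i) := by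
  have hf : f = ∑ i, (f ∘ₗ LinearMap.single k (fun _ => V) i) ∘ₗ LinearMap.proj i := by
    refine LinearMap.ext fun v => ?_
    rw [LinearMap.sum_apply]
    simp only [LinearMap.comp_apply, LinearMap.proj_apply, LinearMap.coe_single]
    rw [← map_sum, Finset.univ_sum_single]
  conv_lhs => rw [hf, map_sum]
  exact Finset.sum_congr rfl fun i _ => LinearMap.trace_comp_comm' _ _

namespace Representation

section Coind

variable {k G V : Type*} [Field k] [Group G] [AddCommGroup V] [Module k V]

/-- The projection of `G → V` onto the equivariant functions, followed by translation by `g`. -/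
noncomputable def coindAverage (N : Subgroup G) [Fintype N] (ρ : Representation k N V) (g : G) :
    (G → V) →ₗ[k] (G → V) :=
  LinearMap.pi fun x => (Nat.card N : k)⁻¹ • ∑ n : N, ρ n⁻¹ ∘ₗ LinearMap.proj ((n : G) * x * g)

theorem coindAverage_apply (N : Subgroup G) [Fintype N] (ρ : Representation k N V) (g : G) (f : G → V)
    (x : G) : coindAverage N ρ g f x =
      (Nat.card N : k)⁻¹ • ∑ n : N, ρ n⁻¹ (f ((n : G) * x * g)) := by
  simp [coindAverage]

theorem coindAverage_mem (N : Subgroup G) [Fintype N] (ρ : Representation k N V) (g : G) (f : G → V) :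
    coindAverage N ρ g f ∈ coindV N.subtype ρ := by
  intro m x
  simp only [coindAverage_apply, map_smul, map_sum]
  congr 1
  refine Fintype.sum_equiv (Equiv.mulRight m) _ _ fun n => ?_
  simp [← Module.End.mul_apply, ← map_mul, mul_assoc]

theorem coindAverage_apply_of_mem [CharZero k] (N : Subgroup G) [Fintype N]
    (ρ : Representation k N V) (g : G) {f : G → V} (hf : f ∈ coindV N.subtype ρ) (x : G) :
    coindAverage N ρ g f x = f (x * g) := by
  have hN : (Nat.card N : k) ≠ 0 := Nat.cast_ne_zero.2 Nat.card_pos.ne'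
  have h : ∀ n : N, ρ n⁻¹ (f ((n : G) * x * g)) = f (x * g) := fun n => by
    have := hf n (x * g)
    rw [Subgroup.subtype_apply, ← mul_assoc] at this
    rw [this, inv_self_apply]
  rw [coindAverage_apply, Finset.sum_congr rfl fun n _ => h n, Finset.sum_const, Finset.card_univ,
    Fintype.card_eq_nat_card, ← Nat.cast_smul_eq_nsmul k, smul_smul, inv_mul_cancel₀ hN, one_smul]

end Coind

section Complex

variable {G V : Type*} [Group G] [AddCommGroup V] [Module ℂ V]

/-- The averaging operator on all of `G → V` has image in the equivariant functions and acts there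
as translation by `g`, so it has the same trace. That trace is read off from diagonal blocks. -/
theorem character_coind [Fintype G] [FiniteDimensional ℂ V] (N : Subgroup G) (ρ : Representation ℂ N V) :
    (coind N.subtype ρ).character = inducedChar N ρ.character := by
  classical
  ext g
  have h1 : (coind N.subtype ρ).character g =
      LinearMap.trace ℂ (G → V) (coindAverage N ρ g) := by
    rw [← LinearMap.trace_restrict_eq_of_forall_mem _ _ (coindAverage_mem N ρ g)]
    refine congrArg (LinearMap.trace ℂ _) (LinearMap.ext fun f => Subtype.ext (funext fun x => ?_))
    exact (coindAverage_apply_of_mem N ρ g f.2 x).symm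
  rw [h1, LinearMap.trace_pi_eq_sum, inducedChar, Finset.mul_sum]
  refine Finset.sum_congr rfl fun x _ => ?_
  have h2 : LinearMap.proj x ∘ₗ coindAverage N ρ g ∘ₗ LinearMap.single ℂ (fun _ => V) x =
      (Nat.card N : ℂ)⁻¹ • ∑ n : N, if (n : G) * x * g = x then ρ n⁻¹ else 0 := by
    refine LinearMap.ext fun v => ?_
    simp only [LinearMap.comp_apply, LinearMap.proj_apply, coindAverage_apply,
      LinearMap.smul_apply, LinearMap.sum_apply, LinearMap.coe_single]
    congr 1
    refine Finset.sum_congr rfl fun n _ => ?_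
    split_ifs with h
    · rw [h, Pi.single_eq_same]
    · rw [Pi.single_eq_of_ne h, map_zero, LinearMap.zero_apply]
  rw [h2, map_smul, map_sum, smul_eq_mul]
  congr 1
  split_ifs with h
  · rw [Finset.sum_eq_single (⟨x * g * x⁻¹, h⟩⁻¹ : N)]
    · simp [character, mul_assoc]
    · intro n _ hn
      rw [if_neg, map_zero]
      rintro e
      apply hn
      rw [eq_inv_iff_mul_eq_one]
      ext
      simp only [Subgroup.coe_mul, Subgroup.coe_one]
      rw [← mul_assoc, ← mul_assoc, e, mul_inv_cancel]
    · simp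
  · refine Finset.sum_eq_zero fun n _ => ?_
    rw [if_neg, map_zero]
    rintro e
    apply h
    have : x * g * x⁻¹ = (n : G)⁻¹ := by
      rw [eq_inv_iff_mul_eq_one, mul_eq_one_iff_eq_inv.2]
      rw [← inv_inv (n : G), mul_assoc, inv_mul_eq_iff_eq_mul] at e
      rw [e]; group
    rw [this]
    exact N.inv_mem n.2

theorem character_mem_Irr [FiniteDimensional ℂ V] (ρ : Representation ℂ G V)
    (h : ρ.IsIrreducible) : ρ.character ∈ Irr G := by
  let e : V ≃ₗ[ℂ] (Fin (finrank ℂ V) → ℂ) := (finBasis ℂ V).equivFun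
  let σ : Representation ℂ G (Fin (finrank ℂ V) → ℂ) := (e.conjRingEquiv : _ →* _).comp ρ
  let E : ρ.Equiv σ := Equiv.mk e fun g => by ext v; simp [σ]
  exact ⟨_, σ, h.of_equiv E, (char_iso E).symm⟩

/-- The sum maps into the `K`-fixed vectors. These form a subrepresentation because `K` is normal,
and it is proper because `K` is not in the kernel. -/
theorem sum_eq_zero_of_not_subset_charKer {N : Type*} [Group N] (K : Subgroup N) [hK : K.Normal]
    [Fintype K] (ρ : Representation ℂ N V) (hρ : ρ.IsIrreducible)
    (h : ¬ (K : Set N) ⊆ charKer ρ.character) : ∑ m : K, ρ m = 0 := by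
  let p : Submodule ℂ V :=
    { carrier := {v | ∀ m ∈ K, ρ m v = v}
      add_mem' := fun {a b} ha hb m hm => by rw [map_add, ha m hm, hb m hm]
      zero_mem' := fun m _ => map_zero _
      smul_mem' := fun c v hv m hm => by rw [map_smul, hv m hm] }
  have hp : p = ⊥ := by
    refine (((isIrreducible_iff_forall_submodule ρ).1 hρ).2 p fun g v hv m hm => ?_).resolve_right
      fun hp => h fun m hm => ?_
    · have hv' := hv (g⁻¹ * m * g) (by simpa using hK.conj_mem m hm g⁻¹)
      calc ρ m (ρ g v) = ρ g (ρ (g⁻¹ * m * g) v) := by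
            simp only [← Module.End.mul_apply, ← map_mul]; group
        _ = ρ g v := by rw [hv']
    · have : ρ m = ρ 1 := LinearMap.ext fun v => by
        rw [map_one]
        exact (hp ▸ Submodule.mem_top : v ∈ p) m hm
      simp only [charKer, Set.mem_ofPred_eq, character, this]
  refine LinearMap.ext fun v => ?_
  have : (∑ m : K, ρ m) v ∈ p := fun m hm => by
    rw [LinearMap.sum_apply, map_sum]
    refine Fintype.sum_equiv (Equiv.mulLeft ⟨m, hm⟩) _ _ fun n => ?_
    simp [← Module.End.mul_apply, ← map_mul]
  rwa [hp, Submodule.mem_bot] at this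

/-- An irreducible representation of `N` on which `M` has no fixed vectors is not isomorphic to its
conjugates by elements `z` for which every element of `z N` acts without fixed points on `M`. -/
theorem false_of_conj_intertwining [Finite G] [FiniteDimensional ℂ V]
    {N M : Subgroup G} [N.Normal] [M.Normal] [Fintype M]
    (hMN : M ≤ N) (ρ : Representation ℂ N V) [ρ.IsIrreducible]
    (hsum : ∑ m : M, ρ ⟨m, hMN m.2⟩ = 0) {z : G}
    (hz : ∀ n : N, Subgroup.centralizer {z * n} ⊓ M = ⊥) (T : V ≃ₗ[ℂ] V)
    (hT : ∀ n : N, T.toLinearMap * ρ n = ρ (MulAut.conjNormal z n) * T.toLinearMap) : False := by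
  have htr : ∀ n : N, LinearMap.trace ℂ V (T.toLinearMap * ρ n) = 0 := by
    intro n
    have hconj : ∀ m : M, LinearMap.trace ℂ V (T.toLinearMap * ρ n * ρ ⟨m, hMN m.2⟩) =
        LinearMap.trace ℂ V (T.toLinearMap * ρ n) := by
      intro m
      obtain ⟨x, hx, hxm⟩ := Subgroup.exists_conj_eq_mul_of_centralizer_inf_eq_bot (hz n) m.2
      let y : N := ⟨x, hMN hx⟩
      -- This is `znm = x⁻¹(zn)x` with `z` cancelled. Moving `T` past the first factor leaves a
      -- conjugation by `ρ y`, which the trace ignores.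
      have hy : n * ⟨m, hMN m.2⟩ = (MulAut.conjNormal z).symm y⁻¹ * n * y := by
        ext
        simp only [Subgroup.coe_mul, MulAut.conjNormal_symm_apply, y, Subgroup.coe_inv]
        calc (n : G) * m = z⁻¹ * (z * n * m) := by group
          _ = _ := by rw [← hxm]; group
      rw [mul_assoc, ← map_mul ρ, hy, map_mul ρ, map_mul ρ, ← mul_assoc, ← mul_assoc, hT,
        MulEquiv.apply_symm_apply, LinearMap.trace_mul_comm, ← mul_assoc, ← mul_assoc,
        ← map_mul ρ, mul_inv_cancel, map_one, one_mul]
    have h0 : ∑ m : M, LinearMap.trace ℂ V (T.toLinearMap * ρ n * ρ ⟨m, hMN m.2⟩) = 0 := by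
      rw [← map_sum, ← Finset.mul_sum, hsum, mul_zero, map_zero]
    rw [Finset.sum_congr rfl fun m _ => hconj m, Finset.sum_const, Finset.card_univ,
      nsmul_eq_mul] at h0
    exact (mul_eq_zero.1 h0).resolve_left (Nat.cast_ne_zero.2 Fintype.card_ne_zero)
  have htr' : ∀ r : MonoidAlgebra ℂ N,
      LinearMap.trace ℂ V (T.toLinearMap * ρ.asAlgebraHom r) = 0 := by
    intro r
    induction r using MonoidAlgebra.induction_linear with
    | zero => simp
    | add a b ha hb => rw [map_add, mul_add, map_add, ha, hb, add_zero]
    | single n c => rw [asAlgebraHom_single, mul_smul_comm, map_smul, htr, smul_zero]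
  obtain ⟨r, hr⟩ := IsIrreducible.asAlgebraHom_surjective ρ T.symm.toLinearMap
  have h1 := htr' r
  have := ((isIrreducible_iff_forall_submodule ρ).1 inferInstance).1
  rw [hr, Module.End.mul_eq_comp, LinearEquiv.comp_coe, LinearEquiv.symm_trans_self,
    LinearEquiv.refl_toLinearMap, LinearMap.trace_id, Nat.cast_eq_zero] at h1
  exact finrank_pos.ne' h1

end Complex

end Representation

/-! ### The norm of the induced character. -/

namespace Representation

section Norm

variable {G V : Type*} [Group G] [Fintype G] [AddCommGroup V] [Module ℂ V]
  [FiniteDimensional ℂ V] {N : Subgroup G} [hN : N.Normal]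

theorem isIrreducible_of_sum_character_eq_card (ρ : Representation ℂ G V)
    (h : ∑ g : G, ρ.character g * ρ.character g⁻¹ = Nat.card G) : ρ.IsIrreducible := by
  have hG : (Nat.card G : ℂ) ≠ 0 := Nat.cast_ne_zero.2 Nat.card_pos.ne'
  have := invertibleOfNonzero hG
  have : NeZero (Nat.card G : ℂ) := ⟨hG⟩
  apply isIrreducible_of_finrank_intertwiningMap_eq_one
  have := card_inv_mul_sum_char_mul_char_eq_finrank ρ ρ
  rw [h, inv_mul_cancel₀ hG] at this
  exact_mod_cast this.symm

theorem inducedChar_apply_coe (ψ : N → ℂ) (n : N) :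
    inducedChar N ψ n = (Nat.card N : ℂ)⁻¹ * ∑ x : G, ψ (MulAut.conjNormal x n) := by
  rw [inducedChar]
  congr 1
  refine Finset.sum_congr rfl fun x _ => ?_
  rw [dif_pos (hN.conj_mem n n.2 x)]
  rfl

theorem inducedChar_apply_of_notMem (ψ : N → ℂ) {g : G} (hg : g ∉ N) :
    inducedChar N ψ g = 0 := by
  rw [inducedChar, Finset.sum_eq_zero, mul_zero]
  intro x _
  rw [dif_neg]
  intro h
  apply hg
  simpa [mul_assoc] using hN.conj_mem _ h x⁻¹

open Classical in
-- Schur orthogonality for the conjugates of `ρ` by `x` and `y`: they are equivalent, via `ρ (x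
-- y⁻¹)`, exactly when `x y⁻¹ ∈ N`.
theorem sum_character_conj_mul_character_conj (ρ : Representation ℂ N V) (hρ : ρ.IsIrreducible)
    (hz : ∀ z ∉ N, ∀ T : V ≃ₗ[ℂ] V,
      ¬ ∀ n : N, T.toLinearMap * ρ n = ρ (MulAut.conjNormal z n) * T.toLinearMap) (x y : G) :
    ∑ n : N, ρ.character (MulAut.conjNormal x n) * ρ.character (MulAut.conjNormal y n)⁻¹ =
      if x * y⁻¹ ∈ N then (Nat.card N : ℂ) else 0 := by
  have hcard : (Nat.card N : ℂ) ≠ 0 := Nat.cast_ne_zero.2 Nat.card_pos.ne'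
  have := invertibleOfNonzero hcard
  let σ : G → Representation ℂ N V := fun x => ρ.comp (MulAut.conjNormal x : N ≃* N).toMonoidHom
  have hσ : ∀ x, (σ x).IsIrreducible := fun x => hρ.comp_mulEquiv _
  have := hσ x
  have := hσ y
  have horth := char_orthonormal (σ x) (σ y)
  have hiff : Nonempty ((σ y).Equiv (σ x)) ↔ x * y⁻¹ ∈ N := by
    constructor
    · rintro ⟨E⟩
      by_contra hxy
      refine hz _ hxy E.toLinearEquiv fun n => LinearMap.ext fun v => ?_
      have h := E.toIntertwiningMap.isIntertwining _ _ ((MulAut.conjNormal y).symm n) v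
      have e1 : σ y ((MulAut.conjNormal y).symm n) = ρ n :=
        congrArg ρ ((MulAut.conjNormal y : N ≃* N).apply_symm_apply n)
      have e2 : σ x ((MulAut.conjNormal y).symm n) = ρ (MulAut.conjNormal (x * y⁻¹) n) := by
        refine congrArg ρ (Subtype.ext ?_)
        simp [mul_assoc]
      rw [e1, e2] at h
      exact h
    · intro h
      let w : N := ⟨x * y⁻¹, h⟩
      refine ⟨IntertwiningMap.ofBijective ⟨ρ w, fun n => ?_⟩ (ρ.apply_bijective w)⟩
      change ρ w * ρ (MulAut.conjNormal y n) = ρ (MulAut.conjNormal x n) * ρ w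
      rw [← map_mul, ← map_mul]
      refine congrArg ρ (Subtype.ext ?_)
      simp [w, mul_assoc]
  rw [inv_mul_eq_iff_eq_mul₀ hcard, if_congr hiff rfl rfl, mul_ite, mul_one,
    mul_zero] at horth
  rw [← horth]
  refine Finset.sum_congr rfl fun n _ => ?_
  rw [← map_inv]
  rfl

theorem sum_inducedChar_mul_inducedChar (ρ : Representation ℂ N V) (hρ : ρ.IsIrreducible)
    (hz : ∀ z ∉ N, ∀ T : V ≃ₗ[ℂ] V,
      ¬ ∀ n : N, T.toLinearMap * ρ n = ρ (MulAut.conjNormal z n) * T.toLinearMap) :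
    ∑ g : G, inducedChar N ρ.character g * inducedChar N ρ.character g⁻¹ = Nat.card G := by
  classical
  have hcard : (Nat.card N : ℂ) ≠ 0 := Nat.cast_ne_zero.2 Nat.card_pos.ne'
  -- For each `x`, exactly `|N|` elements `y` contribute, each giving `|N|`.
  have hcount : ∀ x : G, ∑ y : G, (if x * y⁻¹ ∈ N then (Nat.card N : ℂ) else 0) =
      Nat.card N * Nat.card N := by
    intro x
    have h := Fintype.sum_equiv ((Equiv.inv G).trans (Equiv.mulLeft x))
      (fun y => if x * y⁻¹ ∈ N then (Nat.card N : ℂ) else 0)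
      (fun g => if g ∈ N then (Nat.card N : ℂ) else 0) fun y => rfl
    rw [h, ← Finset.sum_filter, Finset.sum_const, nsmul_eq_mul]
    congr 2
    rw [Nat.card_eq_fintype_card, Fintype.card_subtype]
  calc ∑ g : G, inducedChar N ρ.character g * inducedChar N ρ.character g⁻¹
      = ∑ n : N, inducedChar N ρ.character n * inducedChar N ρ.character (n : G)⁻¹ := by
        rw [← Finset.sum_subset (Finset.subset_univ (Finset.univ.filter (· ∈ N)))]
        · exact Finset.sum_subtype _ (by simp) _
        · intro g _ hg
          rw [inducedChar_apply_of_notMem _ (by simpa using hg), zero_mul]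
    _ = (Nat.card N : ℂ)⁻¹ * (Nat.card N : ℂ)⁻¹ * ∑ x : G, ∑ y : G, ∑ n : N,
          ρ.character (MulAut.conjNormal x n) * ρ.character (MulAut.conjNormal y n)⁻¹ := by
        rw [Finset.sum_congr rfl fun x _ => Finset.sum_comm, Finset.sum_comm, Finset.mul_sum]
        refine Finset.sum_congr rfl fun n _ => ?_
        rw [← Subgroup.coe_inv, inducedChar_apply_coe, inducedChar_apply_coe, mul_mul_mul_comm,
          Finset.sum_mul_sum]
        simp only [map_inv]
    _ = Nat.card G := by
        simp only [sum_character_conj_mul_character_conj ρ hρ hz, hcount, Finset.sum_const,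
          Finset.card_univ, nsmul_eq_mul, Nat.card_eq_fintype_card (α := G)]
        field_simp

theorem inducedChar_mem_Irr_of_centralizer_inf_eq_bot {M : Subgroup G} [M.Normal] (hMN : M ≤ N)
    (hfree : ∀ g : G, g ∉ N → Subgroup.centralizer {g} ⊓ M = ⊥) {ψ : N → ℂ}
    (hψ : ψ ∈ IrrOver N M) : inducedChar N ψ ∈ Irr G := by
  classical
  obtain ⟨⟨d, ρ, hρ, rfl⟩, hker⟩ := hψ
  have hsum : ∑ m : M, ρ ⟨m, hMN m.2⟩ = 0 := by
    rw [← sum_eq_zero_of_not_subset_charKer (M.subgroupOf N) ρ hρ hker]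
    exact Fintype.sum_equiv (Subgroup.subgroupOfEquivOfLe hMN).symm.toEquiv _ _ fun m => rfl
  rw [← character_coind]
  refine character_mem_Irr _ (isIrreducible_of_sum_character_eq_card _ ?_)
  rw [character_coind]
  refine sum_inducedChar_mul_inducedChar ρ hρ fun z hz T hT => ?_
  refine false_of_conj_intertwining hMN ρ hsum (fun n => hfree _ fun hn => hz ?_) T hT
  exact (N.mul_mem_cancel_right n.2).1 hn

end Norm

end Representation

theorem theoremD {G : Type*} [Group G] [Fintype G] (H L M : Subgroup G)
    (hFW : IsFrobeniusWielandt H L) (hM : M.Normal)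
    (hHM : (H : Set G) * (M : Set G) = Set.univ) (hinf : H ⊓ M = ⊥) :
    ∃ N : Subgroup G, IsFrobeniusWielandtKernel H L N ∧
      (N : Set G) = (L : Set G) * (M : Set G) ∧
      IsFrobeniusTriple N M ∧
      (∀ g : G, g ∉ N → Subgroup.centralizer {g} ⊓ M = ⊥) ∧
      ∀ ψ ∈ IrrOver N M, inducedChar N ψ ∈ Irr G := by
  have hN := hFW.sup_normal hHM
  have hfree : ∀ g : G, g ∉ L ⊔ M → Subgroup.centralizer {g} ⊓ M = ⊥ := fun _ hg =>
    hFW.centralizer_inf_eq_bot_of_notMem_sup hHM hinf hg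
  exact ⟨L ⊔ M, hFW.isFrobeniusWielandtKernel_sup hHM hinf, Subgroup.mul_normal L M,
    hFW.isFrobeniusTriple_sup hHM hinf, hfree, fun _ hψ =>
      Representation.inducedChar_mem_Irr_of_centralizer_inf_eq_bot le_sup_right hfree hψ⟩
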